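/- Consider a truss in $\mathbb{R}^d$ with $m$ bars and with $n$ free (not prescribed to be zero) displacement components of its joints. Bar $i$ joins two joints at different positions $y^{(j)},y^{(k)}$, has length $\ell_i=\|y^{(k)}-y^{(j)}\|>0$ and Young's modulus $E_i>0$; its vector of directional cosines $\gamma_i\in\mathbb{R}^n$ is the restriction to the free components of the vector with block $-(y^{(k)}-y^{(j)})/\ell_i$ at joint $j$, block $(y^{(k)}-y^{(j)})/\ell_i$ at joint $k$, and zeros elsewhere. Put $K_i=\frac{E_i}{\ell_i^2}\gamma_i\gamma_i^\top$ and $K(t)=\sum_{i=1}^m t_iK_i$ for $t\in\mathbb{R}^m$, and assume that $K(1,\dots,1)$ is positive definite. Let $f\in\mathbb{R}^n$, $\gamma>0$ and $0\le\underline t_i\le\overline t_i$ for $i=1,\dots,m$, and consider the minimum-volume problem $$\min_{t\in\mathbb{R}^m,\,u\in\mathbb{R}^n}\ \sum_{i=1}^m t_i\quad\text{subject to}\quad K(t)u=f,\quad f^\top u\le\gamma,\quad \underline t_i\le t_i\le\overline t_i\ (i=1,\dots,m).$$ Assume that it is feasible and that the matrix $\begin{pmatrix}\gamma&-f^\top\\-f&K(\underline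 t)\end{pmatrix}$ is not positive definite. (If this matrix is positive definite, the compliance constraint is inactive at the minimum-volume design $t=\underline t$ and every solution of the dual problem below has $X=0$. The assumption holds automatically if $\underline t=0$ and $n\ge1$.) Then the dual semidefinite program $$\max\ \begin{pmatrix}-\gamma&f^\top\\f&0\end{pmatrix}\bullet X-\sum_{i=1}^m\overline\rho_i\overline t_i+\sum_{i=1}^m\underline\rho_i\underline t_i$$ over $X\in\mathbb{S}^{n+1}$ and $\overline\rho,\underline\rho\in\mathbb{R}^m$, subject to $$\begin{pmatrix}0&0\\0&K_i\end{pmatrix}\bullet X-\overline\rho_i+\underline\rho_i=1,\quad \overline\rho_i\ge0,\quad \underline\rho_i\ge0\quad(i=1,\dots,m),\qquad X\succeq0,$$ where $A\bullet B=\operatorname{tr}(A^\top B)$, has an optimal solution $(X^*,\overline\rho^*,\underline\rho^*)$ such that the rank of $X^*$ is exactly one. -/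

import Mathlib

open Matrix

/-- A pin-jointed truss in `ℝ^d` with `N` joints and `m` straight elastic bars.
`pos` are the joint positions, bar `i` joins the joints `src i` and `tgt i` (which are at different
places, so that the bar has positive length), `young` are the Young moduli, and `free` is the set
of the displacement components (joint, coordinate direction) that are not fixed to be zero. -/
structure Truss (d N m : ℕ) where
  pos : Fin N → EuclideanSpace ℝ (Fin d)
  src : Fin m → Fin N
  tgt : Fin m → Fin N
  pos_ne : ∀ i, pos (src i) ≠ pos (tgt i)
  young : Fin m → ℝ
  young_pos : ∀ i, 0 < young i
  free : Finset (Fin N × Fin d)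

namespace Truss

noncomputable section

variable {d N m : ℕ} (T : Truss d N m)

/-- Index type of the free displacement components; its cardinality is the number `n`. -/
abbrev Dof : Type := {q : Fin N × Fin d // q ∈ T.free}

/-- The length `ℓ_i` of bar `i`. -/
def len (i : Fin m) : ℝ := dist (T.pos (T.src i)) (T.pos (T.tgt i))

/-- The vector `γ_i` of directional cosines of bar `i`, restricted to the free components: its
block at the joint `src i` is `-(y^(k) - y^(j)) / ℓ_i`, its block at the joint `tgt i` is
`(y^(k) - y^(j)) / ℓ_i`, where `j = src i`, `k = tgt i`, and all other entries are zero. -/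
def cosines (i : Fin m) : T.Dof → ℝ := fun q =>
  (1 / T.len i) *
    ((if q.1.1 = T.tgt i then 1 else 0) - (if q.1.1 = T.src i then 1 else 0)) *
    (T.pos (T.tgt i) q.1.2 - T.pos (T.src i) q.1.2)

/-- The stiffness matrix `K_i = (E_i / ℓ_i²) γ_i γ_iᵀ` of bar `i`. -/
def barStiffness (i : Fin m) : Matrix T.Dof T.Dof ℝ :=
  (T.young i / T.len i ^ 2) • vecMulVec (T.cosines i) (T.cosines i)

/-- The global stiffness matrix `K(t) = ∑ t_i K_i` for the bar volumes `t`. -/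
def stiffness (t : Fin m → ℝ) : Matrix T.Dof T.Dof ℝ :=
  ∑ i, t i • T.barStiffness i

/-- Feasible points `(t, u)` of the minimum-volume problem
`min ∑ t_i` subject to `K(t) u = f`, `fᵀ u ≤ γ`, `tlo ≤ t ≤ tup`. -/
def VolumeFeasible (f : T.Dof → ℝ) (γ : ℝ) (tlo tup : Fin m → ℝ)
    (t : Fin m → ℝ) (u : T.Dof → ℝ) : Prop :=
  T.stiffness t *ᵥ u = f ∧ f ⬝ᵥ u ≤ γ ∧ ∀ i, tlo i ≤ t i ∧ t i ≤ tup i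

/-- The matrix `S(t) = [γ, -fᵀ; -f, K(t)]` of the linear matrix inequality `S(t) ⪰ 0` of the
primal semidefinite program. -/
def slack (f : T.Dof → ℝ) (γ : ℝ) (t : Fin m → ℝ) :
    Matrix (Unit ⊕ T.Dof) (Unit ⊕ T.Dof) ℝ :=
  fromBlocks (of fun _ _ => γ) (replicateRow Unit (-f)) (replicateCol Unit (-f)) (T.stiffness t)

/-- The Frobenius inner product `A • B = tr(Aᵀ B)`. -/
def frob {ι : Type*} [Fintype ι] (A B : Matrix ι ι ℝ) : ℝ := (Aᵀ * B).trace

/-- The objective of the dual semidefinite program,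
`[-γ, fᵀ; f, 0] • X - ∑ ρup_i tup_i + ∑ ρlo_i tlo_i`. -/
def dualObjective (f : T.Dof → ℝ) (γ : ℝ) (tlo tup : Fin m → ℝ)
    (X : Matrix (Unit ⊕ T.Dof) (Unit ⊕ T.Dof) ℝ) (ρup ρlo : Fin m → ℝ) : ℝ :=
  frob (fromBlocks (of fun _ _ => -γ) (replicateRow Unit f) (replicateCol Unit f) 0) X
    - ∑ i, ρup i * tup i + ∑ i, ρlo i * tlo i

/-- Feasible points `(X, ρup, ρlo)` of the dual semidefinite program: `X` is symmetric positive
semidefinite, `ρup, ρlo ≥ 0`, and `[0, 0; 0, K_i] • X - ρup_i + ρlo_i = 1` for every bar `i`. -/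
def DualFeasible (X : Matrix (Unit ⊕ T.Dof) (Unit ⊕ T.Dof) ℝ) (ρup ρlo : Fin m → ℝ) : Prop :=
  X.PosSemidef ∧ (∀ i, 0 ≤ ρup i) ∧ (∀ i, 0 ≤ ρlo i) ∧
    ∀ i, frob (fromBlocks 0 0 0 (T.barStiffness i)) X - ρup i + ρlo i = 1

/-- Solutions (that is, maximizers) of the dual semidefinite program. -/
def IsDualSolution (f : T.Dof → ℝ) (γ : ℝ) (tlo tup : Fin m → ℝ)
    (X : Matrix (Unit ⊕ T.Dof) (Unit ⊕ T.Dof) ℝ) (ρup ρlo : Fin m → ℝ) : Prop :=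
  T.DualFeasible X ρup ρlo ∧
    ∀ (X' : Matrix (Unit ⊕ T.Dof) (Unit ⊕ T.Dof) ℝ) (ρup' ρlo' : Fin m → ℝ),
      T.DualFeasible X' ρup' ρlo' →
        T.dualObjective f γ tlo tup X' ρup' ρlo' ≤ T.dualObjective f γ tlo tup X ρup ρlo

end

end Truss

/-! Write `X` in blocks with corner `a`, off-diagonal block `w` and lower block `W`. Apart from the
multipliers, the objective sees only `a` and `w`, and by the Schur complement `W ⪰ w wᵀ / a`.
Replacing `W` by `w wᵀ / a` keeps `X ⪰ 0` and lowers every `K_i • W`, which can only help once the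
multipliers are re-optimized. So the dual becomes the maximization of `rankOneValue` over vectors
`x`, and a nonzero maximizer is needed.

Weak duality (`rankOneValue_le`) bounds the value by `∑ tup - xᵀ S(tup) x`, where `S(tup) ⪰ 0`. If
`ker S(tup)` lies in the hyperplane of zero first coordinate, the value is constant along the kernel
and coercive on a complement, so a maximizer exists; should it be `0`, non-definiteness of `S(tlo)`
yields a nonzero one. Otherwise the kernel contains some `(1, u)`, and a large multiple of it
attains the weak duality bound of an explicit design. -/

namespace Truss

noncomputable section

variable {d N m : ℕ} (T : Truss d N m)

/-! ### Optimal multipliers for fixed energies -/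

/-- The strain energy `vᵀ K_i v` of bar `i` per unit of volume. -/
def energy (i : Fin m) (v : T.Dof → ℝ) : ℝ :=
  T.young i / T.len i ^ 2 * (T.cosines i ⬝ᵥ v) ^ 2

/-- The minimum of `s * (1 - q)` over `lo ≤ s ≤ up`. -/
def boxValue (lo up q : ℝ) : ℝ := lo * max (1 - q) 0 - up * max (q - 1) 0

/-- The largest dual objective value for the given matrix `X = x xᵀ`. -/
def rankOneValue (f : T.Dof → ℝ) (γ : ℝ) (tlo tup : Fin m → ℝ) (x : Unit ⊕ T.Dof → ℝ) : ℝ :=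
  -γ * x (Sum.inl ()) ^ 2 + 2 * x (Sum.inl ()) * (f ⬝ᵥ (x ∘ Sum.inr)) +
    ∑ i, boxValue (tlo i) (tup i) (T.energy i (x ∘ Sum.inr))

lemma boxValue_le {lo up s : ℝ} (h1 : lo ≤ s) (h2 : s ≤ up) (q : ℝ) :
    boxValue lo up q ≤ s * (1 - q) := by
  unfold boxValue
  rcases le_total q 1 with h | h
  · rw [max_eq_left (by linarith), max_eq_right (by linarith)]; nlinarith
  · rw [max_eq_right (by linarith), max_eq_left (by linarith)]; nlinarith

lemma boxValue_of_le_one {lo up q : ℝ} (h : q ≤ 1) : boxValue lo up q = lo * (1 - q) := by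
  rw [boxValue, max_eq_left (by linarith), max_eq_right (by linarith)]; ring

lemma boxValue_of_one_le {lo up q : ℝ} (h : 1 ≤ q) : boxValue lo up q = up * (1 - q) := by
  rw [boxValue, max_eq_right (by linarith), max_eq_left (by linarith)]; ring

/-- A minimum of functions of `q` with slopes `-s ≤ 0`; it turns lower bar energies into a better
dual value. -/
lemma boxValue_antitone {lo up : ℝ} (h0 : 0 ≤ lo) (h : lo ≤ up) : Antitone (boxValue lo up) := by
  intro q q' hq
  unfold boxValue
  have h1 : max (1 - q') 0 ≤ max (1 - q) 0 := max_le_max (by linarith) le_rfl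
  have h2 : max (q - 1) 0 ≤ max (q' - 1) 0 := max_le_max (by linarith) le_rfl
  nlinarith [mul_le_mul_of_nonneg_left h1 h0, mul_le_mul_of_nonneg_left h2 (h0.trans h)]

/-- Multipliers with `q - ρup + ρlo = 1` contribute at most `boxValue`. -/
lemma multipliers_le_boxValue {lo up q ρu ρl : ℝ} (h : lo ≤ up) (hu : 0 ≤ ρu) (hl : 0 ≤ ρl)
    (hq : q - ρu + ρl = 1) : -(ρu * up) + ρl * lo ≤ boxValue lo up q := by
  rcases le_total q 1 with h1 | h1
  · rw [boxValue_of_le_one h1, ← hq]; nlinarith [mul_nonneg hu (sub_nonneg.2 h)]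
  · rw [boxValue_of_one_le h1, ← hq]; nlinarith [mul_nonneg hl (sub_nonneg.2 h)]

/-! ### Quadratic forms of `K(t)` and `S(t)`, weak duality -/

lemma len_pos (i : Fin m) : 0 < T.len i := dist_pos.2 (T.pos_ne i)

lemma young_div_pos (i : Fin m) : 0 < T.young i / T.len i ^ 2 :=
  div_pos (T.young_pos i) (pow_pos (T.len_pos i) 2)

lemma energy_nonneg (i : Fin m) (v : T.Dof → ℝ) : 0 ≤ T.energy i v :=
  mul_nonneg (T.young_div_pos i).le (sq_nonneg _)

lemma energy_smul (i : Fin m) (c : ℝ) (v : T.Dof → ℝ) :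
    T.energy i (c • v) = c ^ 2 * T.energy i v := by
  simp only [energy, dotProduct_smul, smul_eq_mul]; ring

lemma energy_eq_zero_iff (i : Fin m) (v : T.Dof → ℝ) :
    T.energy i v = 0 ↔ T.cosines i ⬝ᵥ v = 0 := by
  simp [energy, (T.young_pos i).ne', (T.len_pos i).ne']

lemma stiffness_mulVec (t : Fin m → ℝ) (v : T.Dof → ℝ) :
    T.stiffness t *ᵥ v =
      ∑ i, (t i * (T.young i / T.len i ^ 2) * (T.cosines i ⬝ᵥ v)) • T.cosines i := by
  simp only [stiffness, barStiffness, sum_mulVec, smul_mulVec, vecMulVec_mulVec, op_smul_eq_smul,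
    smul_smul]

lemma dotProduct_stiffness_mulVec (t : Fin m → ℝ) (v w : T.Dof → ℝ) :
    w ⬝ᵥ (T.stiffness t *ᵥ v) =
      ∑ i, t i * (T.young i / T.len i ^ 2) * (T.cosines i ⬝ᵥ v) * (T.cosines i ⬝ᵥ w) := by
  rw [stiffness_mulVec, dotProduct_sum]
  simp only [dotProduct_smul, smul_eq_mul]
  simp only [dotProduct_comm w]

lemma dotProduct_stiffness_mulVec_self (t : Fin m → ℝ) (v : T.Dof → ℝ) :
    v ⬝ᵥ (T.stiffness t *ᵥ v) = ∑ i, t i * T.energy i v := by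
  rw [dotProduct_stiffness_mulVec]
  exact Finset.sum_congr rfl fun i _ => by rw [energy]; ring

lemma slack_mulVec (f : T.Dof → ℝ) (γ : ℝ) (t : Fin m → ℝ) (x : Unit ⊕ T.Dof → ℝ) :
    T.slack f γ t *ᵥ x = Sum.elim (fun _ => γ * x (Sum.inl ()) - f ⬝ᵥ (x ∘ Sum.inr))
      (T.stiffness t *ᵥ (x ∘ Sum.inr) - x (Sum.inl ()) • f) := by
  rw [slack, fromBlocks_mulVec]
  congr 1
  · ext j; simp [mulVec, dotProduct, sub_eq_add_neg]
  · ext j; simp [mulVec, dotProduct]; ring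

lemma dotProduct_slack_mulVec (f : T.Dof → ℝ) (γ : ℝ) (t : Fin m → ℝ) (x : Unit ⊕ T.Dof → ℝ) :
    x ⬝ᵥ (T.slack f γ t *ᵥ x) = γ * x (Sum.inl ()) ^ 2
      - 2 * x (Sum.inl ()) * (f ⬝ᵥ (x ∘ Sum.inr)) + ∑ i, t i * T.energy i (x ∘ Sum.inr) := by
  rw [← dotProduct_stiffness_mulVec_self, slack_mulVec]
  have : x = Sum.elim (fun _ => x (Sum.inl ())) (x ∘ Sum.inr) := by
    ext j; cases j <;> rfl
  conv_lhs => enter [1]; rw [this]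
  rw [sumElim_dotProduct_sumElim, dotProduct_sub, dotProduct_smul, dotProduct_comm _ f]
  simp [dotProduct]
  ring

lemma stiffness_isSymm (t : Fin m → ℝ) : (T.stiffness t)ᵀ = T.stiffness t := by
  simp [stiffness, barStiffness, transpose_sum, transpose_vecMulVec]

lemma slack_isHermitian (f : T.Dof → ℝ) (γ : ℝ) (t : Fin m → ℝ) :
    (T.slack f γ t).IsHermitian := by
  rw [IsHermitian, conjTranspose_eq_transpose_of_trivial, slack, fromBlocks_transpose,
    stiffness_isSymm, transpose_replicateRow, transpose_replicateCol]
  rfl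

/-- A displacement of compliance at most `γ` certifies the linear matrix inequality. -/
lemma slack_posSemidef_of_stiffness_mulVec_eq {f : T.Dof → ℝ} {γ : ℝ} {t : Fin m → ℝ}
    {u : T.Dof → ℝ} (ht : ∀ i, 0 ≤ t i) (hu : T.stiffness t *ᵥ u = f) (hc : f ⬝ᵥ u ≤ γ) :
    (T.slack f γ t).PosSemidef := by
  refine .of_dotProduct_mulVec_nonneg (T.slack_isHermitian f γ t) fun x => ?_
  rw [star_trivial, dotProduct_slack_mulVec]
  set a := x (Sum.inl ())
  set v := x ∘ Sum.inr
  have h1 : f ⬝ᵥ v =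
      ∑ i, t i * (T.young i / T.len i ^ 2) * (T.cosines i ⬝ᵥ u) * (T.cosines i ⬝ᵥ v) := by
    rw [dotProduct_comm, ← hu, dotProduct_stiffness_mulVec]
  have h2 : f ⬝ᵥ u = ∑ i, t i * T.energy i u := by
    rw [dotProduct_comm, ← dotProduct_stiffness_mulVec_self, hu]
  -- Completing the square: the form of `S(t)` is this energy plus `a² (γ - fᵀu)`.
  have h3 : 0 ≤ ∑ i, t i * T.energy i (a • u - v) :=
    Finset.sum_nonneg fun i _ => mul_nonneg (ht i) (T.energy_nonneg i _)
  have h4 : ∑ i, t i * T.energy i (a • u - v) =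
      a ^ 2 * (f ⬝ᵥ u) - 2 * a * (f ⬝ᵥ v) + ∑ i, t i * T.energy i v := by
    rw [h1, h2, Finset.mul_sum, Finset.mul_sum, ← Finset.sum_sub_distrib, ← Finset.sum_add_distrib]
    refine Finset.sum_congr rfl fun i _ => ?_
    simp only [energy, dotProduct_sub, dotProduct_smul, smul_eq_mul]; ring
  nlinarith [mul_le_mul_of_nonneg_left hc (sq_nonneg a)]

/-- Weak duality for matrices of rank at most one. -/
lemma rankOneValue_le (f : T.Dof → ℝ) (γ : ℝ) {tlo tup t : Fin m → ℝ} (h1 : ∀ i, tlo i ≤ t i)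
    (h2 : ∀ i, t i ≤ tup i) (x : Unit ⊕ T.Dof → ℝ) :
    T.rankOneValue f γ tlo tup x ≤ ∑ i, t i - x ⬝ᵥ (T.slack f γ t *ᵥ x) := by
  rw [dotProduct_slack_mulVec, rankOneValue]
  have := Finset.sum_le_sum fun i (_ : i ∈ Finset.univ) =>
    boxValue_le (h1 i) (h2 i) (T.energy i (x ∘ Sum.inr))
  simp only [mul_sub, mul_one, Finset.sum_sub_distrib] at this
  linarith

/-! ### Reduction of the dual to rank one -/

lemma frob_eq_sum {ι : Type*} [Fintype ι] (A B : Matrix ι ι ℝ) :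
    frob A B = ∑ i, ∑ j, A i j * B i j := by
  simp only [frob, trace, diag, mul_apply, transpose_apply]
  exact Finset.sum_comm

lemma frob_barStiffness (i : Fin m) (X : Matrix (Unit ⊕ T.Dof) (Unit ⊕ T.Dof) ℝ) :
    frob (fromBlocks 0 0 0 (T.barStiffness i)) X =
      T.young i / T.len i ^ 2 * (T.cosines i ⬝ᵥ (X.toBlocks₂₂ *ᵥ T.cosines i)) := by
  rw [frob_eq_sum]
  simp only [Fintype.sum_sum_type, barStiffness, dotProduct, mulVec, Finset.mul_sum]
  simp [toBlocks₂₂, vecMulVec_apply]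
  exact Finset.sum_congr rfl fun _ _ => Finset.sum_congr rfl fun _ _ => by ring

lemma frob_objective (f : T.Dof → ℝ) (γ : ℝ) {X : Matrix (Unit ⊕ T.Dof) (Unit ⊕ T.Dof) ℝ}
    (hX : X.IsHermitian) :
    frob (fromBlocks (of fun _ _ => -γ) (replicateRow Unit f) (replicateCol Unit f) 0) X =
      -γ * X (Sum.inl ()) (Sum.inl ()) + 2 * (f ⬝ᵥ fun q => X (Sum.inl ()) (Sum.inr q)) := by
  have h : ∀ q, X (Sum.inr q) (Sum.inl ()) = X (Sum.inl ()) (Sum.inr q) := fun q => by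
    simpa using hX.apply (Sum.inl ()) (Sum.inr q)
  rw [frob_eq_sum]
  simp only [Fintype.sum_sum_type]
  simp [dotProduct, h]
  ring

/-- A dual feasible point is dominated by a matrix of rank at most one. -/
lemma exists_dualObjective_le_rankOneValue (f : T.Dof → ℝ) (γ : ℝ) {tlo tup : Fin m → ℝ}
    (hlo : ∀ i, 0 ≤ tlo i) (hup : ∀ i, tlo i ≤ tup i)
    {X : Matrix (Unit ⊕ T.Dof) (Unit ⊕ T.Dof) ℝ} {ρup ρlo : Fin m → ℝ}
    (h : T.DualFeasible X ρup ρlo) :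
    ∃ x, T.dualObjective f γ tlo tup X ρup ρlo ≤ T.rankOneValue f γ tlo tup x := by
  obtain ⟨hX, hu, hl, hq⟩ := h
  set a := X (Sum.inl ()) (Sum.inl ()) with ha
  set w : T.Dof → ℝ := fun q => X (Sum.inl ()) (Sum.inr q) with hw
  have hsym : ∀ q, X (Sum.inr q) (Sum.inl ()) = w q := fun q => by
    simpa using hX.1.apply (Sum.inl ()) (Sum.inr q)
  have quad : ∀ (s : ℝ) (c : T.Dof → ℝ),
      0 ≤ a * s ^ 2 + 2 * s * (w ⬝ᵥ c) + c ⬝ᵥ (X.toBlocks₂₂ *ᵥ c) := by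
    intro s c
    have := hX.dotProduct_mulVec_nonneg (Sum.elim (fun _ => s) c)
    refine this.trans_eq ?_
    rw [star_trivial, ← fromBlocks_toBlocks X, fromBlocks_mulVec, sumElim_dotProduct_sumElim,
      dotProduct_add]
    have e1 : X.toBlocks₂₁ *ᵥ (fun _ => s) = s • w := by
      ext q; simp [mulVec, dotProduct, toBlocks₂₁, hsym]; ring
    have e2 : (X.toBlocks₁₂ *ᵥ c) () = w ⬝ᵥ c := rfl
    simp only [Sum.elim_comp_inl, Sum.elim_comp_inr, toBlocks_fromBlocks₂₂]
    rw [e1, dotProduct_add c, dotProduct_smul, dotProduct_comm c w]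
    simp [dotProduct, mulVec, toBlocks₁₁, toBlocks₁₂, ← ha, hw, smul_eq_mul]
    ring
  have ha0 : 0 ≤ a := by simpa using quad 1 0
  -- The vector `x = (√a, w / √a)`, or `0` if `a = 0`; the last property is the Schur complement
  -- inequality.
  obtain ⟨x, hx1, hx2, hx3⟩ : ∃ x : Unit ⊕ T.Dof → ℝ, x (Sum.inl ()) ^ 2 = a ∧
      x (Sum.inl ()) • (x ∘ Sum.inr) = w ∧
      ∀ c, (c ⬝ᵥ (x ∘ Sum.inr)) ^ 2 ≤ c ⬝ᵥ (X.toBlocks₂₂ *ᵥ c) := by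
    rcases ha0.eq_or_lt with h0 | hpos
    · refine ⟨0, by simp [← h0], ?_, fun c => by simpa using quad 0 c⟩
      have : w ⬝ᵥ w = 0 := by
        by_contra hne
        -- With `a = 0` the form is affine in `s`; this `s` would give it the value `-1`.
        have := quad (-((w ⬝ᵥ (X.toBlocks₂₂ *ᵥ w)) + 1) / (2 * (w ⬝ᵥ w))) w
        have e : 2 * (-((w ⬝ᵥ (X.toBlocks₂₂ *ᵥ w)) + 1) / (2 * (w ⬝ᵥ w))) * (w ⬝ᵥ w) =
            -((w ⬝ᵥ (X.toBlocks₂₂ *ᵥ w)) + 1) := by field_simp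
        rw [← h0, e] at this
        linarith
      simp [dotProduct_self_eq_zero.1 this]
    · have hs : √a ≠ 0 := (Real.sqrt_pos.2 hpos).ne'
      refine ⟨Sum.elim (fun _ => √a) ((√a)⁻¹ • w), by simp [Real.sq_sqrt ha0], ?_, fun c => ?_⟩
      · simp [smul_smul, hs]
      -- The minimizing `s`.
      · have := quad (-(w ⬝ᵥ c) / a) c
        rw [Sum.elim_comp_inr, dotProduct_smul, smul_eq_mul, mul_pow, inv_pow, Real.sq_sqrt ha0,
          dotProduct_comm c w]
        have e : a * (-(w ⬝ᵥ c) / a) ^ 2 + 2 * (-(w ⬝ᵥ c) / a) * (w ⬝ᵥ c) =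
            -(a⁻¹ * (w ⬝ᵥ c) ^ 2) := by field_simp; ring
        linarith
  refine ⟨x, ?_⟩
  rw [dualObjective, T.frob_objective f γ hX.1, rankOneValue, hx1, mul_assoc 2, ← smul_eq_mul
    (x (Sum.inl ())), ← dotProduct_smul, hx2]
  have : ∀ i, -(ρup i * tup i) + ρlo i * tlo i ≤
      boxValue (tlo i) (tup i) (T.energy i (x ∘ Sum.inr)) := by
    intro i
    refine (multipliers_le_boxValue (hup i) (hu i) (hl i) (hq i)).trans
      (boxValue_antitone (hlo i) (hup i) ?_)
    rw [frob_barStiffness]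
    exact mul_le_mul_of_nonneg_left (hx3 _) (T.young_div_pos i).le
  have := Finset.sum_le_sum fun i (_ : i ∈ Finset.univ) => this i
  rw [Finset.sum_add_distrib, Finset.sum_neg_distrib] at this
  linarith

/-- A nonzero maximizer of `rankOneValue` gives a dual solution of rank one. -/
lemma exists_isDualSolution_of_isMax {f : T.Dof → ℝ} {γ : ℝ} {tlo tup : Fin m → ℝ}
    (hlo : ∀ i, 0 ≤ tlo i) (hup : ∀ i, tlo i ≤ tup i) {x : Unit ⊕ T.Dof → ℝ} (hx : x ≠ 0)
    (hmax : ∀ y, T.rankOneValue f γ tlo tup y ≤ T.rankOneValue f γ tlo tup x) :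
    ∃ (X : Matrix (Unit ⊕ T.Dof) (Unit ⊕ T.Dof) ℝ) (ρup ρlo : Fin m → ℝ),
      T.IsDualSolution f γ tlo tup X ρup ρlo ∧ X.rank = 1 := by
  have hpsd : (vecMulVec x x).PosSemidef := by
    simpa using posSemidef_vecMulVec_self_star x
  have hfrob : ∀ i, frob (fromBlocks 0 0 0 (T.barStiffness i)) (vecMulVec x x) =
      T.energy i (x ∘ Sum.inr) := by
    intro i
    have : (vecMulVec x x).toBlocks₂₂ = vecMulVec (x ∘ Sum.inr) (x ∘ Sum.inr) := rfl
    rw [frob_barStiffness, this, vecMulVec_mulVec, op_smul_eq_smul, dotProduct_smul, smul_eq_mul,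
      energy, dotProduct_comm (x ∘ Sum.inr), ← sq (T.cosines i ⬝ᵥ _)]
  -- Positive and negative parts of `energy - 1`: these multipliers attain `boxValue`.
  refine ⟨vecMulVec x x, fun i => max (T.energy i (x ∘ Sum.inr) - 1) 0,
    fun i => max (1 - T.energy i (x ∘ Sum.inr)) 0,
    ⟨⟨hpsd, fun i => le_max_right _ _, fun i => le_max_right _ _, fun i => ?_⟩, ?_⟩, ?_⟩
  · rw [hfrob]
    beta_reduce
    rcases le_total (T.energy i (x ∘ Sum.inr)) 1 with h | h
    · rw [max_eq_right (by linarith), max_eq_left (by linarith)]; ring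
    · rw [max_eq_left (by linarith), max_eq_right (by linarith)]; ring
  · intro X' ρup' ρlo' h'
    obtain ⟨y, hy⟩ := T.exists_dualObjective_le_rankOneValue f γ hlo hup h'
    refine hy.trans ((hmax y).trans (le_of_eq ?_))
    rw [dualObjective, T.frob_objective f γ hpsd.1, rankOneValue]
    have : (fun q => vecMulVec x x (Sum.inl ()) (Sum.inr q)) = x (Sum.inl ()) • (x ∘ Sum.inr) := rfl
    rw [this, dotProduct_smul, smul_eq_mul, vecMulVec_apply]
    simp only [boxValue, Finset.sum_sub_distrib, mul_comm (tlo _), mul_comm (tup _)]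
    ring
  · refine le_antisymm (rank_vecMulVec_le _ _) (Nat.one_le_iff_ne_zero.2 fun h => hx ?_)
    have h0 : (vecMulVec x x).mulVecLin = 0 := by
      rwa [rank, Submodule.finrank_eq_zero, LinearMap.range_eq_bot] at h
    have h1 : (x ⬝ᵥ x) • x = 0 := by
      simpa [vecMulVec_mulVec] using LinearMap.congr_fun h0 x
    rcases smul_eq_zero.1 h1 with h2 | h2
    · exact dotProduct_self_eq_zero.1 h2
    · exact h2

/-! ### Existence of maximizers -/

/-- If the largest bar volumes just attain the compliance bound, a large multiple of the
equilibrium displacement maximizes `rankOneValue`. -/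
lemma exists_isMax_of_slack_singular {f : T.Dof → ℝ} {γ : ℝ} {tlo tup : Fin m → ℝ}
    (hlo : ∀ i, 0 ≤ tlo i) (hup : ∀ i, tlo i ≤ tup i) {x : Unit ⊕ T.Dof → ℝ}
    (hx : x (Sum.inl ()) ≠ 0) (hker : T.slack f γ tup *ᵥ x = 0) :
    ∃ y, y ≠ 0 ∧ ∀ z, T.rankOneValue f γ tlo tup z ≤ T.rankOneValue f γ tlo tup y := by
  rw [slack_mulVec] at hker
  obtain ⟨u, hγu, hKu⟩ : ∃ u, f ⬝ᵥ u = γ ∧ T.stiffness tup *ᵥ u = f := by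
    refine ⟨(x (Sum.inl ()))⁻¹ • (x ∘ Sum.inr), ?_, ?_⟩
    · have := congrFun hker (Sum.inl ())
      simp only [Sum.elim_inl, Pi.zero_apply] at this
      rw [dotProduct_smul, smul_eq_mul, ← sub_eq_zero.1 this]
      field_simp
    · have : T.stiffness tup *ᵥ (x ∘ Sum.inr) = x (Sum.inl ()) • f := by
        ext q
        have := congrFun hker (Sum.inr q)
        simpa [sub_eq_zero] using this
      rw [mulVec_smul, this, smul_smul, inv_mul_cancel₀ hx, one_smul]
  -- The sum of inverse energies dominates each of them; unstressed bars contribute `0⁻¹ = 0`, and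
  -- the extra `1` keeps `s ≠ 0`.
  obtain ⟨s, hs0, hs⟩ : ∃ s : ℝ, s ≠ 0 ∧ ∀ i, T.energy i u ≠ 0 → 1 ≤ s ^ 2 * T.energy i u := by
    have hnn : ∀ i ∈ Finset.univ, 0 ≤ (T.energy i u)⁻¹ := fun i _ =>
      inv_nonneg.2 (T.energy_nonneg i u)
    have hpos : 0 < 1 + ∑ i, (T.energy i u)⁻¹ := by
      linarith [Finset.sum_nonneg hnn]
    refine ⟨√(1 + ∑ i, (T.energy i u)⁻¹), (Real.sqrt_pos.2 hpos).ne', fun i hi => ?_⟩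
    have hle := Finset.single_le_sum hnn (Finset.mem_univ i)
    rw [Real.sq_sqrt hpos.le]
    calc 1 = (T.energy i u)⁻¹ * T.energy i u := (inv_mul_cancel₀ hi).symm
      _ ≤ _ := mul_le_mul_of_nonneg_right (by linarith) (T.energy_nonneg i u)
  classical
  -- Unstressed bars carry no force, so shrinking them to `tlo` keeps `K(t) u = f`. This design
  -- matches the branch of `boxValue` chosen by `s • u` on every bar.
  set t : Fin m → ℝ := fun i => if T.energy i u = 0 then tlo i else tup i with ht
  have ht1 : ∀ i, tlo i ≤ t i := fun i => by
    simp only [ht]; split_ifs <;> simp [hup i]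
  have ht2 : ∀ i, t i ≤ tup i := fun i => by
    simp only [ht]; split_ifs <;> simp [hup i]
  have hKt : T.stiffness t *ᵥ u = f := by
    rw [← hKu, stiffness_mulVec, stiffness_mulVec]
    refine Finset.sum_congr rfl fun i _ => ?_
    by_cases hi : T.energy i u = 0
    · simp [(T.energy_eq_zero_iff i u).1 hi]
    · simp [ht, hi]
  have hpsd := T.slack_posSemidef_of_stiffness_mulVec_eq (fun i => (hlo i).trans (ht1 i)) hKt hγu.le
  refine ⟨Sum.elim (fun _ => s) (s • u), fun h0 => hs0 (congrFun h0 (Sum.inl ())), fun z => ?_⟩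
  have hz : 0 ≤ z ⬝ᵥ (T.slack f γ t *ᵥ z) := by simpa using hpsd.dotProduct_mulVec_nonneg z
  refine (T.rankOneValue_le f γ ht1 ht2 z).trans ((sub_le_self _ hz).trans (le_of_eq ?_))
  have hbox : ∀ i, boxValue (tlo i) (tup i) (T.energy i (s • u)) =
      t i - s ^ 2 * (t i * T.energy i u) := by
    intro i
    rw [energy_smul]
    by_cases hi : T.energy i u = 0
    · rw [boxValue_of_le_one (by simp [hi])]; simp [ht, hi]
    · rw [boxValue_of_one_le (hs i hi)]; simp only [ht, hi, if_false]; ring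
  have hc : ∑ i, t i * T.energy i u = γ := by
    rw [← dotProduct_stiffness_mulVec_self, hKt, dotProduct_comm, hγu]
  rw [rankOneValue, Sum.elim_comp_inr, Sum.elim_inl, dotProduct_smul, hγu]
  simp only [hbox, Finset.sum_sub_distrib, ← Finset.mul_sum, hc, smul_eq_mul]
  ring

lemma continuous_rankOneValue (f : T.Dof → ℝ) (γ : ℝ) (tlo tup : Fin m → ℝ) :
    Continuous (T.rankOneValue f γ tlo tup) := by
  unfold rankOneValue boxValue energy dotProduct
  simp only [Function.comp_apply]
  fun_prop

lemma rankOneValue_zero (f : T.Dof → ℝ) (γ : ℝ) (tlo tup : Fin m → ℝ) :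
    T.rankOneValue f γ tlo tup 0 = ∑ i, tlo i := by
  have : ((0 : Unit ⊕ T.Dof → ℝ) ∘ Sum.inr) = 0 := rfl
  simp [rankOneValue, boxValue, energy, this]

/-- Shifts along the kernel of `S(tup)` do not change `rankOneValue`, if the kernel consists of
displacements. -/
lemma rankOneValue_add_of_slack_mulVec_eq_zero {f : T.Dof → ℝ} {γ : ℝ} {tlo tup : Fin m → ℝ}
    (hlo : ∀ i, 0 ≤ tlo i) (hup : ∀ i, tlo i ≤ tup i) {k : Unit ⊕ T.Dof → ℝ}
    (hk : T.slack f γ tup *ᵥ k = 0) (hk0 : k (Sum.inl ()) = 0) (x : Unit ⊕ T.Dof → ℝ) :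
    T.rankOneValue f γ tlo tup (k + x) = T.rankOneValue f γ tlo tup x := by
  have hq : k ⬝ᵥ (T.slack f γ tup *ᵥ k) = 0 := by simp [hk]
  rw [dotProduct_slack_mulVec, hk0] at hq
  rw [slack_mulVec, hk0] at hk
  have hf : f ⬝ᵥ (k ∘ Sum.inr) = 0 := by simpa using congrFun hk (Sum.inl ())
  have hnn : ∀ i ∈ Finset.univ, 0 ≤ tup i * T.energy i (k ∘ Sum.inr) := fun i _ =>
    mul_nonneg ((hlo i).trans (hup i)) (T.energy_nonneg i _)
  have hz := (Finset.sum_eq_zero_iff_of_nonneg hnn).1 (by simpa using hq)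
  have hc : (k + x) ∘ Sum.inr = k ∘ Sum.inr + x ∘ Sum.inr := rfl
  rw [rankOneValue, rankOneValue, hc, dotProduct_add, hf, Pi.add_apply, hk0, zero_add, zero_add]
  congr 1
  refine Finset.sum_congr rfl fun i _ => ?_
  rcases mul_eq_zero.1 (hz i (Finset.mem_univ i)) with h | h
  -- A bar with `tup i = 0` has box `{0}` and contributes nothing, whatever its energy.
  · have : tlo i = 0 := le_antisymm (h ▸ hup i) (hlo i)
    simp [boxValue, h, this]
  · rw [energy, energy, dotProduct_add, (T.energy_eq_zero_iff i _).1 h, zero_add]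

/-- If the kernel of `S(tup) ⪰ 0` consists of displacements, then `rankOneValue` has a
maximizer. -/
lemma exists_isMax_of_slack_ker {f : T.Dof → ℝ} {γ : ℝ} {tlo tup : Fin m → ℝ}
    (hlo : ∀ i, 0 ≤ tlo i) (hup : ∀ i, tlo i ≤ tup i) (hS : (T.slack f γ tup).PosSemidef)
    (h : ∀ x, T.slack f γ tup *ᵥ x = 0 → x (Sum.inl ()) = 0) :
    ∃ y, ∀ z, T.rankOneValue f γ tlo tup z ≤ T.rankOneValue f γ tlo tup y := by
  set S := T.slack f γ tup
  obtain ⟨E, hE⟩ := Submodule.exists_isCompl (LinearMap.ker S.mulVecLin)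
  let Q : E → ℝ := fun x => (x : Unit ⊕ T.Dof → ℝ) ⬝ᵥ (S *ᵥ x)
  have hQc : Continuous Q :=
    continuous_subtype_val.dotProduct (continuous_const.matrix_mulVec continuous_subtype_val)
  have hQpos : ∀ x : E, x ≠ 0 → 0 < Q x := by
    intro x hx
    have hnn : 0 ≤ Q x := by simpa using hS.dotProduct_mulVec_nonneg (x : Unit ⊕ T.Dof → ℝ)
    refine hnn.lt_of_ne fun h0 => hx ?_
    have hk : S *ᵥ (x : Unit ⊕ T.Dof → ℝ) = 0 :=
      (hS.dotProduct_mulVec_zero_iff _).1 (by simpa using h0.symm)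
    exact Subtype.ext (Submodule.disjoint_def.1 hE.disjoint _ (by simpa using hk) x.2)
  -- The form is positive definite on `E`, hence bounded below on the unit sphere.
  obtain ⟨δ, hδ, hQ⟩ := (isCompact_sphere (0 : E) 1).exists_forall_le' hQc.continuousOn
    (a := 0) fun x hx => hQpos x (ne_zero_of_mem_unit_sphere ⟨x, hx⟩)
  have hcoer : ∀ x : E, δ * ‖x‖ ^ 2 ≤ Q x := by
    intro x
    rcases eq_or_ne x 0 with rfl | hx
    · simp [Q]
    · have hx' := norm_ne_zero_iff.2 hx
      have h1 := hQ (‖x‖⁻¹ • x) (by rw [mem_sphere_zero_iff_norm, norm_smul, norm_inv, norm_norm, inv_mul_cancel₀ hx'])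
      have h2 : Q (‖x‖⁻¹ • x) = (‖x‖ ^ 2)⁻¹ * Q x := by
        simp only [Q, Submodule.coe_smul, mulVec_smul, dotProduct_smul, smul_dotProduct, smul_eq_mul]
        ring
      rw [h2, inv_mul_eq_div, le_div_iff₀ (by positivity)] at h1
      exact h1
  obtain ⟨y, hy⟩ := ((T.continuous_rankOneValue f γ tlo tup).comp
    (continuous_subtype_val (p := (· ∈ E)))).exists_forall_ge' (0 : E) (by
      -- Far out, `δ ‖x‖² ≥ δ ‖x‖ ≥ ∑ tup - ∑ tlo`, so the value is at most `∑ tlo`, the value at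
      -- `0`.
      filter_upwards [(tendsto_norm_cocompact_atTop (E := E)).eventually_ge_atTop
        (max 1 ((∑ i, tup i - ∑ i, tlo i) / δ))] with x hx
      have h1 : 1 ≤ ‖x‖ := (le_max_left _ _).trans hx
      have h2 : (∑ i, tup i - ∑ i, tlo i) / δ ≤ ‖x‖ := (le_max_right _ _).trans hx
      rw [div_le_iff₀ hδ] at h2
      have h3 := T.rankOneValue_le f γ hup (fun i => le_rfl) (x : Unit ⊕ T.Dof → ℝ)
      have h4 : δ * ‖x‖ ^ 2 ≤ (x : Unit ⊕ T.Dof → ℝ) ⬝ᵥ (S *ᵥ x) := hcoer x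
      have h5 : ‖x‖ * δ ≤ δ * ‖x‖ ^ 2 := by nlinarith [mul_pos hδ (zero_lt_one.trans_le h1)]
      simp only [Function.comp_apply, Submodule.coe_zero, rankOneValue_zero]
      linarith)
  refine ⟨y, fun z => ?_⟩
  obtain ⟨k, hk, e, he, rfl⟩ := Submodule.mem_sup.1 (hE.sup_eq_top ▸ Submodule.mem_top (x := z))
  have hk' : S *ᵥ k = 0 := by simpa using hk
  rw [T.rankOneValue_add_of_slack_mulVec_eq_zero hlo hup hk' (h k hk')]
  exact hy ⟨e, he⟩

/-- If `S(tlo)` is not positive definite, `rankOneValue` is at least `∑ tlo` at some nonzero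
vector. -/
lemma exists_ne_zero_le_rankOneValue {f : T.Dof → ℝ} {γ : ℝ} (tlo tup : Fin m → ℝ)
    (h : ¬ (T.slack f γ tlo).PosDef) :
    ∃ x, x ≠ 0 ∧ ∑ i, tlo i ≤ T.rankOneValue f γ tlo tup x := by
  obtain ⟨x, hx, hxS⟩ : ∃ x, x ≠ 0 ∧ x ⬝ᵥ (T.slack f γ tlo *ᵥ x) ≤ 0 := by
    by_contra! hcon
    exact h (.of_dotProduct_mulVec_pos (T.slack_isHermitian f γ tlo) fun x hx => by
      simpa using hcon x hx)
  set e := ∑ i, T.energy i (x ∘ Sum.inr)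
  have he : 0 ≤ e := Finset.sum_nonneg fun i _ => T.energy_nonneg i _
  -- Scaling brings all energies below `1`, where `rankOneValue` equals `∑ tlo - xᵀ S(tlo) x`.
  set s := (√(1 + e))⁻¹
  have hs : s ^ 2 = (1 + e)⁻¹ := by rw [inv_pow, Real.sq_sqrt (by linarith)]
  have hs0 : s ≠ 0 := inv_ne_zero (Real.sqrt_pos.2 (by linarith)).ne'
  have hle : ∀ i, T.energy i (s • (x ∘ Sum.inr)) ≤ 1 := by
    intro i
    rw [energy_smul, hs, inv_mul_le_one₀ (by linarith)]
    have := Finset.single_le_sum (fun i _ => T.energy_nonneg i (x ∘ Sum.inr)) (Finset.mem_univ i)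
    linarith
  refine ⟨s • x, smul_ne_zero hs0 hx, ?_⟩
  have hc : (s • x) ∘ Sum.inr = s • (x ∘ Sum.inr) := rfl
  rw [dotProduct_slack_mulVec] at hxS
  rw [rankOneValue, hc, Finset.sum_congr rfl fun i _ => boxValue_of_le_one (hle i)]
  simp only [energy_smul, mul_sub, mul_one, Finset.sum_sub_distrib, dotProduct_smul, smul_eq_mul,
    Pi.smul_apply, mul_left_comm (tlo _) (s ^ 2), ← Finset.mul_sum]
  nlinarith [mul_nonneg (sq_nonneg s) (neg_nonneg.2 hxS)]

end

end Truss

theorem mainTheorem3 {d N m : ℕ} (T : Truss d N m)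
    (hK : (T.stiffness (fun _ => 1)).PosDef)
    (f : T.Dof → ℝ) (γ : ℝ) (hγ : 0 < γ)
    (tlo tup : Fin m → ℝ) (hlo : ∀ i, 0 ≤ tlo i) (hup : ∀ i, tlo i ≤ tup i)
    (hfeas : ∃ (t : Fin m → ℝ) (u : T.Dof → ℝ), T.VolumeFeasible f γ tlo tup t u)
    (hnontriv : ¬ (T.slack f γ tlo).PosDef) :
    ∃ (X : Matrix (Unit ⊕ T.Dof) (Unit ⊕ T.Dof) ℝ) (ρup ρlo : Fin m → ℝ),
      T.IsDualSolution f γ tlo tup X ρup ρlo ∧ X.rank = 1 := by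
  obtain ⟨t, u, hu, hc, ht⟩ := hfeas
  have hSt := T.slack_posSemidef_of_stiffness_mulVec_eq (fun i => (hlo i).trans (ht i).1) hu hc
  -- Increasing bar volumes increases `S`.
  have hS : (T.slack f γ tup).PosSemidef := by
    refine .of_dotProduct_mulVec_nonneg (T.slack_isHermitian f γ tup) fun x => ?_
    refine (hSt.dotProduct_mulVec_nonneg x).trans ?_
    rw [star_trivial, T.dotProduct_slack_mulVec, T.dotProduct_slack_mulVec]
    gcongr with i
    · exact T.energy_nonneg i _
    · exact (ht i).2
  suffices ∃ y, y ≠ 0 ∧ ∀ z, T.rankOneValue f γ tlo tup z ≤ T.rankOneValue f γ tlo tup y by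
    obtain ⟨y, hy0, hy⟩ := this
    exact T.exists_isDualSolution_of_isMax hlo hup hy0 hy
  by_cases h : ∀ x, T.slack f γ tup *ᵥ x = 0 → x (Sum.inl ()) = 0
  · obtain ⟨y, hy⟩ := T.exists_isMax_of_slack_ker hlo hup hS h
    rcases eq_or_ne y 0 with rfl | hy0
    -- The maximum is then `∑ tlo`, which a nonzero vector attains too.
    · obtain ⟨x, hx0, hx⟩ := T.exists_ne_zero_le_rankOneValue tlo tup hnontriv
      rw [T.rankOneValue_zero] at hy
      exact ⟨x, hx0, fun z => (hy z).trans hx⟩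
    · exact ⟨y, hy0, hy⟩
  · push Not at h
    obtain ⟨x, hx, hx0⟩ := h
    exact T.exists_isMax_of_slack_singular hlo hup hx0 hx
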